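/- Let $\alpha$ be an infinite regular cardinal. Let $\mathcal T$ and $\mathcal T'$ be two cocomplete triangulated categories, i.e. triangulated categories (with Hom-sets) admitting all set-indexed coproducts. Let $\mathcal G\subset\mathcal T$ and $\mathcal G'\subset\mathcal T'$ be essentially small full subcategories which are $\alpha$-localizing, i.e. they are triangulated subcategories, thick (closed under direct factors), and closed under coproducts of families of their objects indexed by sets of cardinality strictly smaller than $\alpha$. Suppose that $\mathcal G$ satisfies the following conditions in $\mathcal T$, and that $\mathcal G'$ satisfies the same conditions in $\mathcal T'$: (G1) an object $X$ of $\mathcal T$ is zero if $\mathcal T(G,X)=0$ for all $G$ in $\mathcal G$; (G2) for each set-indexed family of morphisms $f_i\colon X_i\to Y_i$, $i\in I$, of $\mathcal T$, the induced map $\mathcal T(G,\coprod_{i\in I}X_i)\to\mathcal T(G,\coprod_{i\in I}Y_i)$ is surjective for all $G$ in $\mathcal G$ if the maps $\mathcal T(G,X_i)\to\mathcal T(G,Y_i)$ are surjective for all $i\in I$ and all $G$ in $\mathcal G$; (G3) every object $G$ of $\mathcal G$ is $\alpha$-small, i.e. for each set-indexed family of objects $X_i$, $i\in I$, of $\mathcal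 T$, each morphism $G\to\coprod_{i\in I}X_i$ factors through a subsum $\coprod_{i\in J}X_i$ for some subset $J\subset I$ of cardinality strictly smaller than $\alpha$. Let $F\colon\mathcal T\to\mathcal T'$ be a triangle functor (not assumed to commute with coproducts). Suppose that $F$ maps the objects of $\mathcal G$ into $\mathcal G'$, that the induced functor $\mathcal G\to\mathcal G'$ is essentially surjective, and that $F$ induces bijections $$\mathcal T(G,X)\longrightarrow\mathcal T'(FG,FX)$$ for all $G$ in $\mathcal G$ and all $X$ in $\mathcal T$. Then $F$ is an equivalence of triangulated categories: there are a triangle functor $H\colon\mathcal T'\to\mathcal T$ and isomorphisms of triangle functors $\mathrm{id}_{\mathcal T}\cong HF$ and $FH\cong\mathrm{id}_{\mathcal T'}$. -/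

import Mathlib

open CategoryTheory CategoryTheory.Limits

universe v u u'

namespace WellGen

section Subcategories

variable {T : Type u} [Category.{v} T] [HasZeroObject T] [HasShift T ℤ] [Preadditive T]
  [∀ n : ℤ, (shiftFunctor T n).Additive] [Pretriangulated T]

/-- A full subcategory `G` of `T` is `α`-localizing if it is a triangulated subcategory which is
thick (it contains the direct factors of its objects; in particular it is closed under
isomorphisms) and closed under coproducts (formed in `T`) of families of its objects indexed by
sets of cardinality strictly smaller than `α`. -/
structure IsCardinalLocalizing (α : Cardinal.{v}) (G : ObjectProperty T) : Prop where
  isTriangulated : G.IsTriangulated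
  isThick : G.IsStableUnderRetracts
  isClosedUnderCoproducts : ∀ J : Type v, Cardinal.mk J < α →
    G.IsClosedUnderColimitsOfShape (Discrete J)

end Subcategories

section Generators

variable {T : Type u} [Category.{v} T]

/-- (G1): an object `X` of `T` is zero as soon as `T(A, X) = 0` for all `A` in `G`. -/
def CondG1 [HasZeroMorphisms T] (G : ObjectProperty T) : Prop :=
  ∀ X : T, (∀ A : T, G A → ∀ f : A ⟶ X, f = 0) → IsZero X

/-- (G2): for each small family of morphisms `f i : X i ⟶ Y i` such that the maps
`T(A, X i) → T(A, Y i)` are surjective for all `i` and all `A` in `G`, the induced maps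
`T(A, ∐ X) → T(A, ∐ Y)` are surjective for all `A` in `G`. -/
def CondG2 [HasCoproducts.{v} T] (G : ObjectProperty T) : Prop :=
  ∀ (I : Type v) (X Y : I → T) (f : ∀ i, X i ⟶ Y i),
    (∀ i, ∀ A : T, G A → Function.Surjective (fun g : A ⟶ X i => g ≫ f i)) →
    ∀ A : T, G A → Function.Surjective (fun g : A ⟶ ∐ X => g ≫ Limits.Sigma.map f)

/-- The canonical morphism from a subsum to the coproduct. -/
noncomputable def subsumInclusion [HasCoproducts.{v} T] {I : Type v} (X : I → T) (J : Set I) :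
    (∐ fun j : J => X j) ⟶ ∐ X :=
  Limits.Sigma.desc fun j : J => Limits.Sigma.ι X j

/-- An object `A` is `α`-small if each morphism from `A` to the coproduct of a small family factors
through a subsum indexed by a subset of cardinality strictly smaller than `α`. -/
def IsCardinalSmall [HasCoproducts.{v} T] (α : Cardinal.{v}) (A : T) : Prop :=
  ∀ (I : Type v) (X : I → T) (f : A ⟶ ∐ X),
    ∃ (J : Set I) (_ : Cardinal.mk J < α) (g : A ⟶ ∐ fun j : J => X j),
      g ≫ subsumInclusion X J = f

/-- (G3) for `α`: all the objects of `G` are `α`-small. -/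
def CondG3 [HasCoproducts.{v} T] (α : Cardinal.{v}) (G : ObjectProperty T) : Prop :=
  ∀ A : T, G A → IsCardinalSmall α A

end Generators

section Equivalences

variable {T : Type u} [Category.{v} T] [HasZeroObject T] [HasShift T ℤ] [Preadditive T]
  [∀ n : ℤ, (shiftFunctor T n).Additive] [Pretriangulated T]
  {T' : Type u'} [Category.{v} T'] [HasZeroObject T'] [HasShift T' ℤ] [Preadditive T']
  [∀ n : ℤ, (shiftFunctor T' n).Additive] [Pretriangulated T']

/-- A triangle functor `F` is an equivalence of triangulated categories if there are a triangle
functor `H` in the other direction and isomorphisms of triangle functors between the identity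
functors and the two composites. -/
def IsTriangleEquivalence (F : T ⥤ T') [F.CommShift ℤ] : Prop :=
  F.IsTriangulated ∧
    ∃ (H : T' ⥤ T) (_ : H.CommShift ℤ) (η : 𝟭 T ≅ F ⋙ H) (ε : H ⋙ F ≅ 𝟭 T'),
      H.IsTriangulated ∧ NatTrans.CommShift η.hom ℤ ∧ NatTrans.CommShift ε.hom ℤ

end Equivalences

end WellGen

open CategoryTheory.Pretriangulated

namespace WellGen

/-! ### Coproducts, shifts and distinguished triangles -/

section ShiftCoproducts

variable {T : Type u} [Category.{v} T] [HasShift T ℤ] {J : Type*} (X : J → T) [HasCoproduct X]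

/-! Two facts carry the proof: `F` preserves coproducts, and `G`, `G'` generate.

Generation (`prop_of_generates`): a triangulated subcategory closed under coproducts and containing
`G` is everything, by a homotopy colimit argument from (G1) and (G2).

Preservation (`isIso_sigmaComparison`): by (G1) for `G'`, the comparison `∐ F X_i ⟶ F (∐ X_i)` may
be tested on maps from `F A` with `A` in `G`. By smallness and (G2) such maps factor through
coproducts of fewer than `α` objects of `G` or `G'`. There the comparison is invertible because `F`
restricts to an equivalence from `G` to `G'`.

Hence the objects `X` on which `F` is bijective on all `T(X, Y)` form a localizing subcategory
containing `G`, so `F` is fully faithful. Its essential image is then a localizing subcategory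
containing `G'`, so `F` is essentially surjective. -/

lemma exists_shift_desc (n : ℤ) {W : T} (γ : ∀ j, (X j)⟦n⟧ ⟶ W) :
    ∃ γ' : (∐ X)⟦n⟧ ⟶ W, ∀ j, (Sigma.ι X j)⟦n⟧' ≫ γ' = γ j := by
  let h := isColimitOfHasCoproductOfPreservesColimit (shiftFunctor T n) X
  exact ⟨Cofan.IsColimit.desc h γ, fun j => Cofan.IsColimit.fac h γ j⟩

lemma shift_sigma_hom_ext (n : ℤ) {W : T} {f g : (∐ X)⟦n⟧ ⟶ W}
    (h : ∀ j, (Sigma.ι X j)⟦n⟧' ≫ f = (Sigma.ι X j)⟦n⟧' ≫ g) : f = g :=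
  Cofan.IsColimit.hom_ext
    (isColimitOfHasCoproductOfPreservesColimit (shiftFunctor T n) X) _ _ h

end ShiftCoproducts

section CoproductTriangles

variable {T : Type u} [Category.{v} T] [HasZeroObject T] [HasShift T ℤ] [Preadditive T]
  [∀ n : ℤ, (shiftFunctor T n).Additive] [Pretriangulated T]

section Exactness

variable {X Y Z W : T} {f : X ⟶ Y} {g : Y ⟶ Z} {h : Z ⟶ X⟦(1 : ℤ)⟧}
  (hT : Triangle.mk f g h ∈ distTriang T)
include hT

lemma exists_desc₂ (φ : Y ⟶ W) (hφ : f ≫ φ = 0) : ∃ ψ : Z ⟶ W, g ≫ ψ = φ := by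
  obtain ⟨ψ, hψ⟩ := Triangle.yoneda_exact₂ _ hT φ hφ
  exact ⟨ψ, hψ.symm⟩

lemma exists_desc₃ (φ : Z ⟶ W) (hφ : g ≫ φ = 0) : ∃ ψ : X⟦(1 : ℤ)⟧ ⟶ W, h ≫ ψ = φ :=
  exists_desc₂ (rot_of_distTriang _ hT) φ hφ

lemma exists_desc_shift (φ : X⟦(1 : ℤ)⟧ ⟶ W) (hφ : h ≫ φ = 0) :
    ∃ ψ : Y⟦(1 : ℤ)⟧ ⟶ W, f⟦(1 : ℤ)⟧' ≫ ψ = φ := by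
  obtain ⟨ψ, hψ⟩ : ∃ ψ : Y⟦(1 : ℤ)⟧ ⟶ W, (-f⟦(1 : ℤ)⟧') ≫ ψ = φ :=
    exists_desc₃ (rot_of_distTriang _ hT) φ hφ
  exact ⟨-ψ, by rw [← hψ, Preadditive.comp_neg, Preadditive.neg_comp]⟩

lemma exists_lift₂ (φ : W ⟶ Y) (hφ : φ ≫ g = 0) : ∃ ψ : W ⟶ X, ψ ≫ f = φ := by
  obtain ⟨ψ, hψ⟩ := Triangle.coyoneda_exact₂ _ hT φ hφ
  exact ⟨ψ, hψ.symm⟩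

lemma exists_lift_shift (φ : W ⟶ X⟦(1 : ℤ)⟧) (hφ : φ ≫ f⟦(1 : ℤ)⟧' = 0) :
    ∃ ψ : W ⟶ Z, ψ ≫ h = φ := by
  obtain ⟨ψ, hψ⟩ := Triangle.coyoneda_exact₁ _ hT φ hφ
  exact ⟨ψ, hψ.symm⟩

lemma distinguished_of_iso₃ {Z' : T} {g' : Y ⟶ Z'} (e : Z' ⟶ Z) [IsIso e] (he : g' ≫ e = g) :
    Triangle.mk f g' (e ≫ h) ∈ distTriang T := by
  let i : Z' ≅ Z := asIso e
  refine isomorphic_distinguished _ hT _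
    (Triangle.isoMk (Triangle.mk f g' (e ≫ h)) (Triangle.mk f g h)
      (Iso.refl X) (Iso.refl Y) i ?_ ?_ ?_)
  · exact (Category.comp_id f).trans (Category.id_comp f).symm
  · exact he.trans (Category.id_comp g).symm
  · change (e ≫ h) ≫ (𝟙 X)⟦(1 : ℤ)⟧' = e ≫ h
    rw [CategoryTheory.Functor.map_id, Category.comp_id]

end Exactness

/-- A coproduct of distinguished triangles can be completed to a distinguished triangle. -/
lemma exists_distinguished_sigma {J : Type*} {X Y Z : J → T} [HasCoproduct X] [HasCoproduct Y]
    [HasCoproduct Z] (f : ∀ j, X j ⟶ Y j) (g : ∀ j, Y j ⟶ Z j) (h : ∀ j, Z j ⟶ (X j)⟦(1 : ℤ)⟧)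
    (hT : ∀ j, Triangle.mk (f j) (g j) (h j) ∈ distTriang T) :
    ∃ k : ∐ Z ⟶ (∐ X)⟦(1 : ℤ)⟧,
      Triangle.mk (Limits.Sigma.map f) (Limits.Sigma.map g) k ∈ distTriang T := by
  obtain ⟨C, p, q, hC⟩ := distinguished_cocone_triangle (Limits.Sigma.map f)
  have hθ (j : J) : ∃ θ : Z j ⟶ C, g j ≫ θ = Sigma.ι Y j ≫ p ∧
      h j ≫ (Sigma.ι X j)⟦(1 : ℤ)⟧' = θ ≫ q := by
    obtain ⟨θ, h₁, h₂⟩ := complete_distinguished_triangle_morphism _ _ (hT j) hC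
      (Sigma.ι X j) (Sigma.ι Y j) (Sigma.ι_map f j).symm
    exact ⟨θ, h₁, h₂⟩
  choose θ hθ₁ hθ₂ using hθ
  have hfp : Limits.Sigma.map f ≫ p = 0 := comp_distTriang_mor_zero₁₂ _ hC
  have hqf : q ≫ (Limits.Sigma.map f)⟦(1 : ℤ)⟧' = 0 := comp_distTriang_mor_zero₃₁ _ hC
  have hfg (j : J) : f j ≫ g j = 0 := comp_distTriang_mor_zero₁₂ _ (hT j)
  have hι (j : J) : Sigma.ι Z j ≫ Sigma.desc θ = θ j := Sigma.ι_desc _ _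
  -- Five lemma for `Hom(-, W)`: on the side of `∐ Z` the exact sequence is a product of those of
  -- the given triangles, so liftings are chosen componentwise.
  have : IsIso (Sigma.desc θ) := by
    refine isIso_of_coyoneda_map_bijective _ fun W => ⟨fun a b hab => ?_, fun φ => ?_⟩
    · rw [← sub_eq_zero]
      generalize hα : a - b = α
      have hθα (j : J) : θ j ≫ α = 0 := by
        rw [← hα, Preadditive.comp_sub, sub_eq_zero, ← hι, Category.assoc, Category.assoc]
        exact Sigma.ι Z j ≫= hab
      obtain ⟨β, rfl⟩ := exists_desc₃ hC α (Sigma.hom_ext _ _ fun j => by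
        rw [comp_zero, ← Category.assoc, ← hθ₁, Category.assoc, hθα, comp_zero])
      have hγ (j : J) : ∃ γ : (Y j)⟦(1 : ℤ)⟧ ⟶ W,
          (f j)⟦(1 : ℤ)⟧' ≫ γ = (Sigma.ι X j)⟦(1 : ℤ)⟧' ≫ β :=
        exists_desc_shift (hT j) _ (by rw [← Category.assoc, hθ₂, Category.assoc, hθα])
      choose γ hγ using hγ
      obtain ⟨γ', hγ'⟩ := exists_shift_desc Y 1 γ
      have : β = (Limits.Sigma.map f)⟦(1 : ℤ)⟧' ≫ γ' := shift_sigma_hom_ext _ _ fun j => by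
        rw [← hγ, ← hγ', ← Category.assoc, ← Category.assoc, ← Functor.map_comp,
          ← Functor.map_comp, Sigma.ι_map]
      rw [this, ← Category.assoc, hqf, zero_comp]
    · obtain ⟨α, hα⟩ := exists_desc₂ hC (Limits.Sigma.map g ≫ φ) (Sigma.hom_ext _ _ fun j => by
        rw [Sigma.ι_map_assoc, Sigma.ι_map_assoc, reassoc_of% hfg, zero_comp, comp_zero])
      have hδ (j : J) : ∃ δ : (X j)⟦(1 : ℤ)⟧ ⟶ W, h j ≫ δ = Sigma.ι Z j ≫ φ - θ j ≫ α :=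
        exists_desc₃ (hT j) _ (by
          have := Sigma.ι Y j ≫= hα
          rw [Sigma.ι_map_assoc] at this
          rw [Preadditive.comp_sub, ← this, ← Category.assoc (g j), hθ₁, Category.assoc, sub_self])
      choose δ hδ using hδ
      obtain ⟨δ', hδ'⟩ := exists_shift_desc X 1 δ
      refine ⟨α + q ≫ δ', Sigma.hom_ext _ _ fun j => ?_⟩
      rw [← Category.assoc, hι, Preadditive.comp_add, ← Category.assoc (θ j), ← hθ₂,
        Category.assoc, hδ', hδ, add_sub_cancel]
  refine ⟨_, distinguished_of_iso₃ hC (Sigma.desc θ) (Sigma.hom_ext _ _ fun j => ?_)⟩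
  rw [Sigma.ι_map_assoc, hι, hθ₁]

end CoproductTriangles

/-! ### Covers by generators and generation -/

section Covers

/-- One summand is taken for each morphism to `X` from a representative of `G`; every morphism is
then its own lift. -/
lemma exists_cover {T : Type u} [Category.{v} T] [HasCoproducts.{v} T] (G : ObjectProperty T)
    [ObjectProperty.EssentiallySmall.{v} G] (X : T) :
    ∃ (K : Type v) (P : K → T) (π : ∀ k, P k ⟶ X), (∀ k, G (P k)) ∧
      ∀ A : T, G A → Function.Surjective (fun g : A ⟶ ∐ P => g ≫ Sigma.desc π) := by
  obtain ⟨Q, _, hQG, hGQ⟩ := ObjectProperty.EssentiallySmall.exists_small_le.{v} G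
  let e := equivShrink.{v} (Subtype Q)
  refine ⟨Σ a : Shrink.{v} (Subtype Q), ((e.symm a).1 ⟶ X), fun k => (e.symm k.1).1,
    fun k => k.2, fun k => hQG _ (e.symm k.1).2, fun A hA f => ?_⟩
  obtain ⟨B, hB, ⟨i⟩⟩ := hGQ _ hA
  obtain ⟨a, ha⟩ := e.symm.surjective ⟨B, hB⟩
  obtain rfl : (e.symm a).1 = B := by rw [ha]
  exact ⟨i.hom ≫ Sigma.ι (fun k : Σ a : Shrink.{v} (Subtype Q), ((e.symm a).1 ⟶ X) =>
    (e.symm k.1).1) ⟨a, i.inv ≫ f⟩, by simp⟩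

end Covers

section Generation

variable {T : Type u} [Category.{v} T] [HasZeroObject T] [HasShift T ℤ] [Preadditive T]
  [∀ n : ℤ, (shiftFunctor T n).Additive] [Pretriangulated T]

/-- The fibre of `f` receives only zero maps from `A` in `G`: injectivity is used at `A`,
surjectivity at `A⟦1⟧`. -/
lemma isIso_of_bijective_of_condG1 {G : ObjectProperty T} [G.IsStableUnderShift ℤ]
    (hG1 : CondG1 G) {X Y : T} (f : X ⟶ Y)
    (hf : ∀ A : T, G A → Function.Bijective (fun g : A ⟶ X => g ≫ f)) : IsIso f := by
  obtain ⟨Z, p, q, hT⟩ := distinguished_cocone_triangle₁ f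
  have hpf : p ≫ f = 0 := comp_distTriang_mor_zero₁₂ _ hT
  have hfq : f ≫ q = 0 := comp_distTriang_mor_zero₂₃ _ hT
  suffices IsZero Z from (Triangle.isZero₁_iff_isIso₂ _ hT).1 this
  refine hG1 _ fun A hA g => ?_
  have hgp : g ≫ p = 0 := (hf A hA).1 (by simp [hpf])
  obtain ⟨a, ha⟩ := exists_lift_shift hT (g⟦(1 : ℤ)⟧')
    (by rw [← Functor.map_comp, hgp, Functor.map_zero])
  obtain ⟨b, rfl⟩ := (hf _ (G.le_shift 1 _ hA)).2 a
  apply (shiftFunctor T (1 : ℤ)).map_injective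
  rw [← ha, Category.assoc, hfq, comp_zero, Functor.map_zero]

lemma trW_of_trW_comp [IsTriangulated T] {L : ObjectProperty T} [L.IsTriangulated]
    [L.IsClosedUnderIsomorphisms] {X Y Z : T} (f : X ⟶ Y) (g : Y ⟶ Z) (hg : L.trW g)
    (hfg : L.trW (f ≫ g)) : L.trW f := by
  obtain ⟨A, a, b, hT⟩ := distinguished_cocone_triangle f
  obtain ⟨B, c, d, hT', hB⟩ := hg
  obtain ⟨C, e, k, hT'', hC⟩ := hfg
  exact ⟨A, a, b, hT, L.ext_of_isTriangulatedClosed₁ _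
    (Triangulated.someOctahedron rfl hT hT' hT'').mem hC hB⟩

lemma trW_sigmaMap {L : ObjectProperty T} {J : Type*} {X Y : J → T} [HasCoproductsOfShape J T]
    (hL : ∀ Z : J → T, (∀ j, L (Z j)) → L (∐ Z)) (f : ∀ j, X j ⟶ Y j) (hf : ∀ j, L.trW (f j)) :
    L.trW (Limits.Sigma.map f) := by
  choose Z g h hT hZ using hf
  obtain ⟨k, hk⟩ := exists_distinguished_sigma f g h hT
  exact ⟨_, _, _, hk, hL _ hZ⟩

/-- The endomorphism of the coproduct of a sequence induced by its transition morphisms. -/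
noncomputable abbrev succShift [HasCoproducts.{v} T] {Z : ℕ → T} (s : ∀ n, Z n ⟶ Z (n + 1)) :
    (∐ fun i : ULift.{v} ℕ => Z i.down) ⟶ ∐ fun i : ULift.{v} ℕ => Z i.down :=
  Sigma.desc fun i => s i.down ≫ Sigma.ι (fun i : ULift.{v} ℕ => Z i.down) ⟨i.down + 1⟩

/-- The homotopy colimit of the constant sequence is `X`: `1 - t` is a split monomorphism with
cokernel the codiagonal `σ`. -/
lemma prop_of_trW_one_sub_succShift [HasCoproducts.{v} T] {L : ObjectProperty T}
    [L.IsClosedUnderIsomorphisms] (X : T)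
    (h : L.trW (𝟙 _ - succShift (fun _ : ℕ => 𝟙 X))) : L X := by
  set t := succShift (fun _ : ℕ => 𝟙 X)
  let ι (n : ℕ) : X ⟶ ∐ fun _ : ULift.{v} ℕ => X := Sigma.ι (fun _ : ULift.{v} ℕ => X) ⟨n⟩
  have hι (n : ℕ) : ι n ≫ t = ι (n + 1) := by simp [ι, t, succShift]
  let σ : (∐ fun _ : ULift.{v} ℕ => X) ⟶ X := Sigma.desc fun _ => 𝟙 X
  have hσ (n : ℕ) : ι n ≫ σ = 𝟙 X := by simp [ι, σ]
  -- Chosen so that `ι n ≫ r - ι (n + 1) ≫ r = ι n`, with value zero at `n = 0`.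
  let r : (∐ fun _ : ULift.{v} ℕ => X) ⟶ ∐ fun _ : ULift.{v} ℕ => X :=
    Sigma.desc fun i => -∑ k ∈ Finset.range i.down, ι k
  have hr (n : ℕ) : ι n ≫ r = -∑ k ∈ Finset.range n, ι k := by simp [ι, r]
  have hext {W : T} {a b : (∐ fun _ : ULift.{v} ℕ => X) ⟶ W} (hab : ∀ n, ι n ≫ a = ι n ≫ b) :
      a = b := Sigma.hom_ext _ _ fun i => hab i.down
  have hσt : (𝟙 _ - t) ≫ σ = 0 := hext fun n => by
    rw [Preadditive.sub_comp, Preadditive.comp_sub, ← Category.assoc, ← Category.assoc, hι]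
    simp [hσ]
  have hrt : (𝟙 _ - t) ≫ r = 𝟙 _ := hext fun n => by
    rw [Preadditive.sub_comp, Preadditive.comp_sub, ← Category.assoc, ← Category.assoc, hι,
      Category.comp_id, hr, hr, Finset.sum_range_succ]
    abel
  have htr : r ≫ (𝟙 _ - t) + σ ≫ ι 0 = 𝟙 _ := hext fun n => by
    rw [Preadditive.comp_add, ← Category.assoc, ← Category.assoc, hσ, hr, Category.comp_id,
      Category.id_comp, Preadditive.neg_comp, Preadditive.sum_comp]
    have : ∀ k, ι k ≫ (𝟙 _ - t) = ι k - ι (k + 1) := fun k => by simp [Preadditive.comp_sub, hι]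
    simp only [this, Finset.sum_range_sub']
    abel
  obtain ⟨C, p, q, hT, hC⟩ := h
  have : Mono (𝟙 _ - t) := mono_of_mono_fac hrt
  have : Epi p := Triangle.epi₂ _ hT (Triangle.mor₃_eq_zero_of_mono₁ _ hT ‹_›)
  have hp : (𝟙 _ - t) ≫ p = 0 := comp_distTriang_mor_zero₁₂ _ hT
  obtain ⟨σ', hσ'⟩ := exists_desc₂ hT σ hσt
  refine L.prop_of_iso (X := C) ⟨σ', ι 0 ≫ p, ?_, ?_⟩ hC
  · rw [← cancel_epi p, ← Category.assoc, hσ', ← Category.assoc, eq_sub_of_add_eq' htr, Preadditive.sub_comp,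
      Category.assoc, hp, comp_zero, sub_zero, Category.id_comp, Category.comp_id]
  · rw [Category.assoc, hσ', hσ]

/-- Iterated cones of covers give a sequence starting at `X`, with homotopy colimit zero, whose maps
from `X` have cones in `L`. Comparing with the constant sequence on `X` puts the cone of its `1 -
t`, which is `X`, in `L`. -/
theorem prop_of_generates [IsTriangulated T] [HasCoproducts.{v} T] {G : ObjectProperty T}
    [ObjectProperty.EssentiallySmall.{v} G] [G.IsStableUnderShift ℤ]
    (hG1 : CondG1 G) (hG2 : CondG2 G) (L : ObjectProperty T) [L.IsTriangulated]
    [L.IsClosedUnderIsomorphisms]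
    (hL : ∀ (J : Type v) (Z : J → T), (∀ j, L (Z j)) → L (∐ Z)) (hGL : G ≤ L) (X : T) : L X := by
  have key (Z : T) : ∃ (P Z' : T) (π : P ⟶ Z) (s : Z ⟶ Z'), π ≫ s = 0 ∧ L.trW s ∧
      ∀ A : T, G A → Function.Surjective (fun g : A ⟶ P => g ≫ π) := by
    obtain ⟨K, P, π, hP, hπ⟩ := exists_cover G Z
    obtain ⟨Z', s, q, hT⟩ := distinguished_cocone_triangle (Sigma.desc π)
    exact ⟨_, Z', _, s, comp_distTriang_mor_zero₁₂ _ hT,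
      ObjectProperty.trW.mk' L hT (hL _ _ fun k => hGL _ (hP k)), hπ⟩
  choose P Z' π s hπs hs hπ using key
  let Z (n : ℕ) : T := Nat.rec X (fun _ => Z') n
  let sZ (n : ℕ) : Z n ⟶ Z (n + 1) := s (Z n)
  let φ (n : ℕ) : X ⟶ Z n := Nat.rec (motive := fun n => X ⟶ Z n) (𝟙 X) (fun n f => f ≫ sZ n) n
  have hφ (n : ℕ) : L.trW (φ n) := by
    induction n with
    | zero => exact MorphismProperty.id_mem _ X
    | succ n ih => exact MorphismProperty.comp_mem _ _ _ ih (hs _)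
  -- By (G2) `g` lifts to the coproduct of the covers, which the transition maps kill. So `1 -
  -- succShift` acts as the identity on maps from `G`.
  have ht (A : T) (hA : G A) (g : A ⟶ ∐ fun i : ULift.{v} ℕ => Z i.down) :
      g ≫ succShift sZ = 0 := by
    obtain ⟨g', rfl⟩ := hG2 (ULift.{v} ℕ) _ _ (fun i => π (Z i.down))
      (fun i A hA => hπ _ A hA) A hA g
    dsimp only
    have : Limits.Sigma.map (fun i : ULift.{v} ℕ => π (Z i.down)) ≫ succShift sZ = 0 := by
      ext i
      simp [succShift, sZ, reassoc_of% hπs]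
    rw [Category.assoc, this, comp_zero]
  have : IsIso (𝟙 _ - succShift sZ) := isIso_of_bijective_of_condG1 hG1 _ fun A hA => by
    have : (fun g : A ⟶ _ => g ≫ (𝟙 _ - succShift sZ)) = id := by
      ext g
      simp [Preadditive.comp_sub, ht A hA g]
    rw [this]
    exact Function.bijective_id
  have hφZ := trW_sigmaMap (L := L) (hL _) (fun i : ULift.{v} ℕ => φ i.down) fun i => hφ _
  refine prop_of_trW_one_sub_succShift X (trW_of_trW_comp _ _ hφZ ?_)
  have comm : (𝟙 _ - succShift (fun _ : ℕ => 𝟙 X)) ≫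
      Limits.Sigma.map (fun i : ULift.{v} ℕ => φ i.down) =
      Limits.Sigma.map (fun i : ULift.{v} ℕ => φ i.down) ≫ (𝟙 _ - succShift sZ) := by
    ext i
    simp [Preadditive.comp_sub, Preadditive.sub_comp, succShift, φ]
  rw [comm]
  exact MorphismProperty.comp_mem _ _ _ hφZ (L.trW_of_isIso _)

end Generation

/-! ### Factorization through small coproducts -/

section SmallFactorization

variable {T : Type u} [Category.{v} T] [HasCoproducts.{v} T] {α : Cardinal.{v}}
  {G : ObjectProperty T}

lemma prop_sigma (hGα : ∀ J : Type v, Cardinal.mk J < α →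
    G.IsClosedUnderColimitsOfShape (Discrete J)) {J : Type v} (hJ : Cardinal.mk J < α)
    (C : J → T) (hC : ∀ j, G (C j)) : G (∐ C) := by
  have := hGα J hJ
  exact G.prop_colimit _ fun j => hC j.as

/-- A morphism from an object of `G` to a coproduct factors componentwise through a coproduct of
objects of `G`. -/
lemma exists_factorization_of_lt [ObjectProperty.EssentiallySmall.{v} G]
    (hGα : ∀ J : Type v, Cardinal.mk J < α → G.IsClosedUnderColimitsOfShape (Discrete J))
    (hG2 : CondG2 G) (hG3 : CondG3 α G) {J : Type v} (X : J → T) {A : T} (hA : G A)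
    (f : A ⟶ ∐ X) :
    ∃ (C : J → T) (p : ∀ j, C j ⟶ X j) (g : A ⟶ ∐ C), (∀ j, G (C j)) ∧
      g ≫ Limits.Sigma.map p = f := by
  choose K P π hP hπ using fun j => exists_cover G (X j)
  obtain ⟨f', hf'⟩ := hG2 J _ _ (fun j => Sigma.desc (π j)) hπ A hA f
  let P' (i : Σ j, K j) : T := P i.1 i.2
  let a : (∐ fun j => ∐ P j) ⟶ ∐ P' := Sigma.desc fun j => Sigma.desc fun k => Sigma.ι P' ⟨j, k⟩
  obtain ⟨S, hS, g, hg⟩ := hG3 A hA _ P' (f' ≫ a)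
  -- The fewer than `α` summands that `f'` meets are regrouped by `j`; each slice embeds in `S`, so
  -- its coproduct stays in `G`.
  let S' (j : J) : Type v := {k : K j // (⟨j, k⟩ : Σ j, K j) ∈ S}
  let C (j : J) : T := ∐ fun k : S' j => P j k.1
  let b : (∐ fun i : S => P' i) ⟶ ∐ C := Sigma.desc fun i =>
    Sigma.ι (fun k : S' i.1.1 => P i.1.1 k.1) ⟨i.1.2, i.2⟩ ≫ Sigma.ι C i.1.1
  let p (j : J) : C j ⟶ X j := Sigma.desc fun k => π j k.1
  let q : ∐ P' ⟶ ∐ X := Sigma.desc fun i => π i.1 i.2 ≫ Sigma.ι X i.1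
  refine ⟨C, p, g ≫ b, fun j => ?_, ?_⟩
  · refine prop_sigma hGα (lt_of_le_of_lt ?_ hS) _ fun k => hP j k.1
    exact Cardinal.mk_le_of_injective (f := fun k : S' j => (⟨⟨j, k.1⟩, k.2⟩ : S))
      fun k l hkl => Subtype.ext (by simpa [Subtype.ext_iff] using hkl)
  · have h₁ : b ≫ Limits.Sigma.map p = subsumInclusion P' S ≫ q := by
      ext i
      simp [b, p, q, subsumInclusion]
    have h₂ : a ≫ q = Limits.Sigma.map fun j => Sigma.desc (π j) := by
      ext j k
      simp [a, q]
    rw [Category.assoc, h₁, ← Category.assoc, hg, Category.assoc, h₂]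
    exact hf'

end SmallFactorization

section SubsumRetraction

variable {T : Type u} [Category.{v} T] [HasZeroMorphisms T] [HasCoproducts.{v} T]

open Classical in
lemma exists_retraction_subsumInclusion {I : Type v} (X : I → T) (J : Set I) :
    ∃ r : ∐ X ⟶ ∐ fun j : J => X j, subsumInclusion X J ≫ r = 𝟙 _ := by
  refine ⟨Sigma.desc fun i => if h : i ∈ J then Sigma.ι (fun j : J => X j) ⟨i, h⟩ else 0, ?_⟩
  ext j
  simp [subsumInclusion]

end SubsumRetraction

/-! ### Preservation of coproducts -/

section ComparisonNaturality

variable {T : Type u} [Category.{v} T] [HasCoproducts.{v} T]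
  {T' : Type u'} [Category.{v} T'] [HasCoproducts.{v} T'] {F : T ⥤ T'}

lemma sigmaMap_comp_sigmaComparison {J : Type v} {X Y : J → T} (f : ∀ j, X j ⟶ Y j) :
    Limits.Sigma.map (fun j => F.map (f j)) ≫ sigmaComparison F Y =
      sigmaComparison F X ≫ F.map (Limits.Sigma.map f) := by
  ext j
  rw [Sigma.ι_map_assoc, ι_comp_sigmaComparison, ι_comp_sigmaComparison_assoc, ← F.map_comp,
    ← F.map_comp, Sigma.ι_map]

lemma subsumInclusion_comp_sigmaComparison {I : Type v} (X : I → T) (J : Set I) :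
    subsumInclusion (fun i => F.obj (X i)) J ≫ sigmaComparison F X =
      sigmaComparison F (fun j : J => X j) ≫ F.map (subsumInclusion X J) := by
  ext j
  simp only [subsumInclusion, Sigma.ι_desc_assoc]
  rw [ι_comp_sigmaComparison, ι_comp_sigmaComparison_assoc, ← F.map_comp, Sigma.ι_desc]

end ComparisonNaturality

section Comparison

variable {T : Type u} [Category.{v} T] [HasZeroObject T] [HasShift T ℤ] [Preadditive T]
  [∀ n : ℤ, (shiftFunctor T n).Additive] [Pretriangulated T] [HasCoproducts.{v} T]
  {T' : Type u'} [Category.{v} T'] [HasZeroObject T'] [HasShift T' ℤ] [Preadditive T']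
  [∀ n : ℤ, (shiftFunctor T' n).Additive] [Pretriangulated T'] [HasCoproducts.{v} T']
  {α : Cardinal.{v}} {G : ObjectProperty T} {G' : ObjectProperty T'} {F : T ⥤ T'}

/-- The coproduct of the `F (C j)` lies in `G'`, hence is some `F D` with `D` in `G`; its inclusions
lift to `C j ⟶ D` and define the inverse. -/
lemma isIso_sigmaComparison_of_lt (hG : IsCardinalLocalizing α G) (hG' : IsCardinalLocalizing α G')
    (hF : ∀ A : T, G A → G' (F.obj A))
    (hFsurj : ∀ B : T', G' B → ∃ A : T, G A ∧ Nonempty (F.obj A ≅ B))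
    (hFbij : ∀ A X : T, G A → Function.Bijective (fun f : A ⟶ X => F.map f))
    {J : Type v} (hJ : Cardinal.mk J < α) (C : J → T) (hC : ∀ j, G (C j)) :
    IsIso (sigmaComparison F C) := by
  obtain ⟨D, hD, ⟨e⟩⟩ := hFsurj _
    (prop_sigma hG'.isClosedUnderCoproducts hJ (fun j => F.obj (C j)) fun j => hF _ (hC j))
  have hGC := prop_sigma hG.isClosedUnderCoproducts hJ C hC
  choose d hd using fun j => (hFbij (C j) D (hC j)).2 (Sigma.ι (fun j => F.obj (C j)) j ≫ e.inv)
  dsimp only at hd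
  have h₁ : sigmaComparison F C ≫ F.map (Sigma.desc d) ≫ e.hom = 𝟙 _ := by
    ext j
    rw [ι_comp_sigmaComparison_assoc, ← Category.assoc, ← F.map_comp, Sigma.ι_desc, hd]
    simp
  obtain ⟨s, hs⟩ := (hFbij _ _ hGC).2 (F.map (Sigma.desc d) ≫ e.hom ≫ sigmaComparison F C)
  dsimp only at hs
  have hs' : s = 𝟙 _ := Sigma.hom_ext _ _ fun j => (hFbij _ _ (hC j)).1 <| by
    dsimp only
    rw [F.map_comp, hs, ← ι_comp_sigmaComparison, Category.assoc, reassoc_of% h₁, Category.comp_id,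
      ι_comp_sigmaComparison]
  exact ⟨_, h₁, by rw [Category.assoc, ← hs, hs', F.map_id]⟩

variable [ObjectProperty.EssentiallySmall.{v} G]

lemma surjective_comp_sigmaComparison
    (hG : IsCardinalLocalizing α G) (hG2 : CondG2 G) (hG3 : CondG3 α G)
    (hG' : IsCardinalLocalizing α G')
    (hF : ∀ A : T, G A → G' (F.obj A))
    (hFsurj : ∀ B : T', G' B → ∃ A : T, G A ∧ Nonempty (F.obj A ≅ B))
    (hFbij : ∀ A X : T, G A → Function.Bijective (fun f : A ⟶ X => F.map f))
    {I : Type v} (X : I → T) {A : T} (hA : G A) (f : F.obj A ⟶ F.obj (∐ X)) :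
    ∃ g, g ≫ sigmaComparison F X = f := by
  obtain ⟨f, rfl⟩ := (hFbij _ _ hA).2 f
  obtain ⟨J, hJ, f, rfl⟩ := hG3 A hA I X f
  obtain ⟨C, p, g, hC, rfl⟩ :=
    exists_factorization_of_lt hG.isClosedUnderCoproducts hG2 hG3 _ hA f
  have := isIso_sigmaComparison_of_lt hG hG' hF hFsurj hFbij hJ C hC
  refine ⟨F.map g ≫ inv (sigmaComparison F C) ≫ Limits.Sigma.map (fun j => F.map (p j)) ≫
    subsumInclusion (fun i => F.obj (X i)) J, ?_⟩
  simp only [Category.assoc, subsumInclusion_comp_sigmaComparison]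
  rw [← Category.assoc (Limits.Sigma.map _), sigmaMap_comp_sigmaComparison]
  simp

/-- If a morphism from an object of `G` to a coproduct of objects of `G` is annihilated by a
coproduct of morphisms, it factors through a coproduct of morphisms from objects of `G`
each of which is annihilated. -/
lemma exists_factorization_of_comp_sigmaMap_eq_zero
    (hGα : ∀ J : Type v, Cardinal.mk J < α → G.IsClosedUnderColimitsOfShape (Discrete J))
    (hG2 : CondG2 G) (hG3 : CondG3 α G)
    {J : Type v} {C X : J → T} (p : ∀ j, C j ⟶ X j) {A : T} (hA : G A) (u : A ⟶ ∐ C)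
    (hu : u ≫ Limits.Sigma.map p = 0) :
    ∃ (D : J → T) (d : ∀ j, D j ⟶ C j) (w : A ⟶ ∐ D), (∀ j, G (D j)) ∧
      (∀ j, d j ≫ p j = 0) ∧ w ≫ Limits.Sigma.map d = u := by
  -- The coproduct of the fibres of the `p j` is a fibre of their coproduct, so `u` lifts to it.
  choose K k q hT using fun j => distinguished_cocone_triangle₁ (p j)
  obtain ⟨q', hq'⟩ := exists_distinguished_sigma k p q hT
  obtain ⟨w, rfl⟩ := exists_lift₂ hq' u hu
  obtain ⟨D, d, w, hD, rfl⟩ := exists_factorization_of_lt hGα hG2 hG3 _ hA w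
  have hkp (j : J) : k j ≫ p j = 0 := comp_distTriang_mor_zero₁₂ _ (hT j)
  refine ⟨D, fun j => d j ≫ k j, w, hD, fun j => by rw [Category.assoc, hkp, comp_zero], ?_⟩
  rw [Category.assoc]
  congr 1
  ext j
  simp

variable [ObjectProperty.EssentiallySmall.{v} G']

/-- Up to small comparisons, `g` is `F u` followed by a coproduct of maps `F (p j)`. Faithfulness on
`G` gives `u ≫ ∐ p = 0` in `T`; this becomes the componentwise relation `d j ≫ p j = 0`, which `F`
carries back to `T'`. -/
lemma eq_zero_of_comp_sigmaComparison_eq_zero [F.PreservesZeroMorphisms]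
    (hG : IsCardinalLocalizing α G) (hG2 : CondG2 G) (hG3 : CondG3 α G)
    (hG' : IsCardinalLocalizing α G') (hG2' : CondG2 G') (hG3' : CondG3 α G')
    (hF : ∀ A : T, G A → G' (F.obj A))
    (hFsurj : ∀ B : T', G' B → ∃ A : T, G A ∧ Nonempty (F.obj A ≅ B))
    (hFbij : ∀ A X : T, G A → Function.Bijective (fun f : A ⟶ X => F.map f))
    {I : Type v} (X : I → T) {A : T} (hA : G A) (g : F.obj A ⟶ ∐ fun i => F.obj (X i))
    (hg : g ≫ sigmaComparison F X = 0) : g = 0 := by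
  obtain ⟨J, hJ, g, rfl⟩ := hG3' _ (hF A hA) I _ g
  -- The subsum inclusion is split, so `F` keeps it monic and the problem reduces to `J`.
  obtain ⟨r, hr⟩ := exists_retraction_subsumInclusion X J
  have hg₀ : g ≫ sigmaComparison F (fun j : J => X j) = 0 := by
    have := hg =≫ F.map r
    rw [Category.assoc g, subsumInclusion_comp_sigmaComparison] at this
    simpa only [Category.assoc, ← F.map_comp, hr, F.map_id, Category.comp_id, zero_comp] using this
  obtain ⟨B, b, g, hB, rfl⟩ :=
    exists_factorization_of_lt hG'.isClosedUnderCoproducts hG2' hG3' _ (hF A hA) g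
  choose C hC e using fun j => hFsurj (B j) (hB j)
  replace e (j : J) := (e j).some
  choose p hp using fun j => (hFbij (C j) (X j) (hC j)).2 ((e j).hom ≫ b j)
  dsimp only at hp
  have hiso := isIso_sigmaComparison_of_lt hG hG' hF hFsurj hFbij hJ C hC
  obtain ⟨u, hu⟩ := (hFbij A (∐ C) hA).2
    (g ≫ Limits.Sigma.map (fun j => (e j).inv) ≫ sigmaComparison F C)
  dsimp only at hu
  have hb : Limits.Sigma.map b = Limits.Sigma.map (fun j => (e j).inv) ≫
      Limits.Sigma.map fun j => F.map (p j) := by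
    ext j
    simp [hp]
  have hg₁ : g = F.map u ≫ inv (sigmaComparison F C) ≫ Limits.Sigma.map (fun j => (e j).hom) := by
    have : Limits.Sigma.map (fun j => (e j).inv) ≫ Limits.Sigma.map (fun j => (e j).hom) =
        𝟙 (∐ B) := by
      ext j
      simp
    simp [hu, this]
  have hup : u ≫ Limits.Sigma.map p = 0 := (hFbij _ _ hA).1 <| by
    dsimp only
    rw [F.map_comp, hu, F.map_zero, ← hg₀, hb]
    simp only [Category.assoc, sigmaMap_comp_sigmaComparison]
  obtain ⟨D, d, w, hD, hd, rfl⟩ := exists_factorization_of_comp_sigmaMap_eq_zero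
    hG.isClosedUnderCoproducts hG2 hG3 p hA u hup
  have hiso' := isIso_sigmaComparison_of_lt hG hG' hF hFsurj hFbij hJ D hD
  have hw : F.map (Limits.Sigma.map d) ≫ inv (sigmaComparison F C) =
      inv (sigmaComparison F D) ≫ Limits.Sigma.map fun j => F.map (d j) := by
    rw [IsIso.comp_inv_eq, Category.assoc, sigmaMap_comp_sigmaComparison, IsIso.inv_hom_id_assoc]
  have hzero : Limits.Sigma.map (fun j => F.map (d j)) ≫ Limits.Sigma.map (fun j => (e j).hom) ≫
      Limits.Sigma.map b = 0 := by
    ext j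
    have : F.map (d j) ≫ (e j).hom ≫ b j = 0 := by rw [← hp, ← F.map_comp, hd, F.map_zero]
    simp [reassoc_of% this]
  rw [hg₁, F.map_comp]
  simp only [Category.assoc, reassoc_of% hw, reassoc_of% hzero, zero_comp, comp_zero]

theorem isIso_sigmaComparison [F.Additive]
    (hG : IsCardinalLocalizing α G) (hG2 : CondG2 G) (hG3 : CondG3 α G)
    (hG' : IsCardinalLocalizing α G') (hG1' : CondG1 G') (hG2' : CondG2 G') (hG3' : CondG3 α G')
    (hF : ∀ A : T, G A → G' (F.obj A))
    (hFsurj : ∀ B : T', G' B → ∃ A : T, G A ∧ Nonempty (F.obj A ≅ B))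
    (hFbij : ∀ A X : T, G A → Function.Bijective (fun f : A ⟶ X => F.map f))
    {I : Type v} (X : I → T) : IsIso (sigmaComparison F X) := by
  have := hG'.isTriangulated
  refine isIso_of_bijective_of_condG1 hG1' _ fun B hB => ?_
  obtain ⟨A, hA, ⟨e⟩⟩ := hFsurj B hB
  refine ⟨fun a b hab => ?_, fun f => ?_⟩
  · rw [← sub_eq_zero, ← cancel_epi e.hom, comp_zero]
    refine eq_zero_of_comp_sigmaComparison_eq_zero hG hG2 hG3 hG' hG2' hG3' hF hFsurj hFbij X hA _ ?_
    dsimp only at hab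
    simp [Preadditive.sub_comp, hab]
  · obtain ⟨g, hg⟩ := surjective_comp_sigmaComparison hG hG2 hG3 hG' hF hFsurj hFbij X hA
      (e.hom ≫ f)
    exact ⟨e.inv ≫ g, by simp [hg]⟩

end Comparison

/-! ### The localizing subcategory where `F` is fully faithful -/

section FullyFaithful

variable {T : Type u} [Category.{v} T] {T' : Type u'} [Category.{v} T'] (F : T ⥤ T')

/-- The objects `X` such that `F` induces bijections `T(X, Y) → T'(FX, FY)` for all `Y`. -/
def mapBijective : ObjectProperty T :=
  fun X => ∀ Y : T, Function.Bijective (fun f : X ⟶ Y => F.map f)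

instance : (mapBijective F).IsClosedUnderIsomorphisms where
  of_iso {X X'} e hX Y := by
    refine ⟨fun f g hfg => ?_, fun f => ?_⟩
    · rw [← cancel_epi e.hom]
      apply (hX Y).1
      dsimp only at hfg ⊢
      rw [F.map_comp, F.map_comp, hfg]
    · obtain ⟨g, hg⟩ := (hX Y).2 (F.map e.hom ≫ f)
      dsimp only at hg
      exact ⟨e.inv ≫ g, by simp [hg]⟩

lemma mapBijective_sigma {J : Type*} (X : J → T) [HasCoproduct X]
    [HasCoproduct fun j => F.obj (X j)] [IsIso (sigmaComparison F X)]
    (hX : ∀ j, mapBijective F (X j)) : mapBijective F (∐ X) := fun Y => by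
  refine ⟨fun f g hfg => Sigma.hom_ext _ _ fun j => (hX j Y).1 ?_, fun f => ?_⟩
  · dsimp only at hfg ⊢
    rw [F.map_comp, F.map_comp, hfg]
  · choose g hg using fun j => (hX j Y).2 (F.map (Sigma.ι X j) ≫ f)
    dsimp only at hg
    refine ⟨Sigma.desc g, ?_⟩
    dsimp only
    rw [← cancel_epi (sigmaComparison F X)]
    ext j
    rw [ι_comp_sigmaComparison_assoc, ι_comp_sigmaComparison_assoc, ← F.map_comp, Sigma.ι_desc, hg]

instance [HasShift T ℤ] [HasShift T' ℤ] [F.CommShift ℤ] :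
    (mapBijective F).IsStableUnderShift ℤ where
  isStableUnderShiftBy n :=
    { le_shift := fun X hX Y => by
        -- Writing the target as a shift turns maps `X⟦n⟧ ⟶ Y` into maps `X ⟶ Y'`.
        obtain ⟨Y', ⟨e⟩⟩ : ∃ Y' : T, Nonempty (Y'⟦n⟧ ≅ Y) :=
          ⟨_, ⟨(shiftFunctor T n).objObjPreimageIso Y⟩⟩
        refine ⟨fun f g hfg => ?_, fun f => ?_⟩
        · rw [← cancel_mono e.inv]
          obtain ⟨f', hf'⟩ := (shiftFunctor T n).map_surjective (f ≫ e.inv)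
          obtain ⟨g', hg'⟩ := (shiftFunctor T n).map_surjective (g ≫ e.inv)
          rw [← hf', ← hg']
          congr 1
          apply (hX Y').1
          dsimp only at hfg ⊢
          apply (shiftFunctor T' n).map_injective
          rw [← cancel_epi ((F.commShiftIso n).hom.app X)]
          have hnat {a : X ⟶ Y'} := (F.commShiftIso n).hom.naturality a
          dsimp only [Functor.comp_map] at hnat
          rw [← hnat, ← hnat, hf', hg', F.map_comp, F.map_comp, hfg]
        · obtain ⟨g, hg⟩ := (shiftFunctor T' n).map_surjective
            ((F.commShiftIso n).inv.app X ≫ f ≫ F.map e.inv ≫ (F.commShiftIso n).hom.app Y')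
          obtain ⟨h, rfl⟩ := (hX Y').2 g
          refine ⟨h⟦n⟧' ≫ e.hom, ?_⟩
          have hnat := (F.commShiftIso n).hom.naturality h
          dsimp only [Functor.comp_map] at hnat
          dsimp only at hg ⊢
          rw [hg, Iso.hom_inv_id_app_assoc, ← Category.assoc f, cancel_mono] at hnat
          rw [F.map_comp, hnat, Category.assoc, ← F.map_comp, e.inv_hom_id, F.map_id,
            Category.comp_id] }

variable [HasZeroObject T] [HasShift T ℤ] [Preadditive T]
  [∀ n : ℤ, (shiftFunctor T n).Additive] [Pretriangulated T]
  [HasZeroObject T'] [HasShift T' ℤ] [Preadditive T']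
  [∀ n : ℤ, (shiftFunctor T' n).Additive] [Pretriangulated T'] [F.CommShift ℤ] [F.IsTriangulated]

instance : (mapBijective F).IsTriangulated where
  exists_zero := ⟨_, isZero_zero T, fun Y =>
    ⟨fun f g _ => (isZero_zero T).eq_of_src f g,
      fun f => ⟨0, (F.map_isZero (isZero_zero T)).eq_of_src _ f⟩⟩⟩
  toIsTriangulatedClosed₂ := .mk' (by
    rintro ⟨X, Z, W, f, g, h⟩ hT hX hW Y
    change ∀ Y, Function.Bijective _ at hX hW
    have hFT : Triangle.mk (F.map f) (F.map g) (F.map h ≫ (F.commShiftIso (1 : ℤ)).hom.app X) ∈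
      distTriang T' := F.map_distinguished _ hT
    have hX₁ := (mapBijective F).le_shift (1 : ℤ) _ hX Y
    have hgh : g ≫ h = 0 := comp_distTriang_mor_zero₂₃ _ hT
    have hhf : F.map h ≫ (F.commShiftIso (1 : ℤ)).hom.app X ≫ (F.map f)⟦(1 : ℤ)⟧' = 0 :=
      (Category.assoc _ _ _).symm.trans <| comp_distTriang_mor_zero₃₁ _ hFT
    refine ⟨fun a b hab => ?_, fun φ => ?_⟩
    · change Z ⟶ Y at a b
      dsimp only at hab
      rw [← sub_eq_zero]
      have hc : F.map (a - b) = 0 := by rw [F.map_sub, hab, sub_self]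
      obtain ⟨c, hgc⟩ := exists_desc₂ hT (a - b) ((hX Y).1 (by
        dsimp only
        rw [F.map_comp, hc, comp_zero, F.map_zero]))
      obtain ⟨k, hk⟩ := exists_desc₃ hFT (F.map c) (by rw [← F.map_comp, hgc, hc])
      obtain ⟨l, hl⟩ := hX₁.2 ((F.commShiftIso (1 : ℤ)).hom.app X ≫ k)
      dsimp only at hl
      have hcl : c = h ≫ l := (hW Y).1 (by dsimp only; rw [F.map_comp, hl, ← hk, Category.assoc])
      rw [← hgc, hcl, reassoc_of% hgh, zero_comp]
    · change F.obj Z ⟶ F.obj Y at φ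
      obtain ⟨a, ha⟩ := (hX Y).2 (F.map f ≫ φ)
      dsimp only at ha
      -- This step of the five lemma uses the hypothesis on `W` with target `Y⟦1⟧`, hence the
      -- quantification over all targets.
      have hha : h ≫ a⟦(1 : ℤ)⟧' = 0 := (hW _).1 <| by
        dsimp only
        have hnat := (F.commShiftIso (1 : ℤ)).hom.naturality a
        dsimp only [Functor.comp_map] at hnat
        rw [← cancel_mono ((F.commShiftIso (1 : ℤ)).hom.app Y), F.map_comp, Category.assoc, hnat,
          ha, Functor.map_comp, reassoc_of% hhf, F.map_zero, zero_comp,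
          zero_comp]
      obtain ⟨b', hb'⟩ := exists_desc_shift hT _ hha
      obtain ⟨b, rfl⟩ := (shiftFunctor T (1 : ℤ)).map_surjective b'
      have hfb : f ≫ b = a := (shiftFunctor T (1 : ℤ)).map_injective (by
        rw [CategoryTheory.Functor.map_comp, hb'])
      obtain ⟨g', hg'⟩ := exists_desc₂ hFT (φ - F.map b) (by
        rw [Preadditive.comp_sub, ← F.map_comp, hfb, ha, sub_self])
      obtain ⟨c, rfl⟩ := (hW Y).2 g'
      refine ⟨b + g ≫ c, ?_⟩
      dsimp only at hg' ⊢
      rw [F.map_add, F.map_comp, hg', add_sub_cancel])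

end FullyFaithful

/-! ### From equivalence to triangle equivalence -/

section Equivalence

variable {T : Type u} [Category.{v} T] [HasZeroObject T] [HasShift T ℤ] [Preadditive T]
  [∀ n : ℤ, (shiftFunctor T n).Additive] [Pretriangulated T]
  {T' : Type u'} [Category.{v} T'] [HasZeroObject T'] [HasShift T' ℤ] [Preadditive T']
  [∀ n : ℤ, (shiftFunctor T' n).Additive] [Pretriangulated T']

lemma isTriangleEquivalence_functor (E : T ≌ T') [E.functor.CommShift ℤ]
    [E.functor.IsTriangulated] : IsTriangleEquivalence E.functor := by
  -- The inverse takes the shift structure transported along the adjunction, which makes unit and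
  -- counit compatible with shifts.
  let _ := E.commShiftInverse ℤ
  have hE : E.CommShift ℤ := E.commShift_of_functor ℤ
  have := Equivalence.IsTriangulated.mk' E inferInstance
  exact ⟨inferInstance, E.inverse, inferInstance, E.unitIso, E.counitIso, inferInstance,
    inferInstance, inferInstance⟩

lemma isTriangleEquivalence_of_isEquivalence (F : T ⥤ T') [hF : F.CommShift ℤ]
    [hF' : F.IsTriangulated] [F.IsEquivalence] : IsTriangleEquivalence F :=
  @isTriangleEquivalence_functor _ _ _ _ _ _ _ _ _ _ _ _ _ _ F.asEquivalence hF hF'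

end Equivalence

end WellGen

theorem theorem2p6
    {T : Type u} [Category.{v} T] [HasZeroObject T] [HasShift T ℤ] [Preadditive T]
    [∀ n : ℤ, (shiftFunctor T n).Additive] [Pretriangulated T] [IsTriangulated T]
    [HasCoproducts.{v} T]
    {T' : Type u'} [Category.{v} T'] [HasZeroObject T'] [HasShift T' ℤ] [Preadditive T']
    [∀ n : ℤ, (shiftFunctor T' n).Additive] [Pretriangulated T'] [IsTriangulated T']
    [HasCoproducts.{v} T']
    (α : Cardinal.{v}) (hα : α.IsRegular)
    (G : ObjectProperty T) [ObjectProperty.EssentiallySmall.{v} G]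
    (hG : WellGen.IsCardinalLocalizing α G)
    (hG1 : WellGen.CondG1 G) (hG2 : WellGen.CondG2 G) (hG3 : WellGen.CondG3 α G)
    (G' : ObjectProperty T') [ObjectProperty.EssentiallySmall.{v} G']
    (hG' : WellGen.IsCardinalLocalizing α G')
    (hG1' : WellGen.CondG1 G') (hG2' : WellGen.CondG2 G') (hG3' : WellGen.CondG3 α G')
    (F : T ⥤ T') [F.CommShift ℤ] [F.IsTriangulated]
    (hF : ∀ A : T, G A → G' (F.obj A))
    (hFsurj : ∀ B : T', G' B → ∃ A : T, G A ∧ Nonempty (F.obj A ≅ B))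
    (hFbij : ∀ A X : T, G A →
      Function.Bijective (fun f : A ⟶ X => F.map f)) :
    WellGen.IsTriangleEquivalence F := by
  have := hG.isTriangulated
  have := hG'.isTriangulated
  have hiso (J : Type v) (X : J → T) : IsIso (sigmaComparison F X) :=
    WellGen.isIso_sigmaComparison hG hG2 hG3 hG' hG1' hG2' hG3' hF hFsurj hFbij X
  have hbij (X : T) : WellGen.mapBijective F X :=
    WellGen.prop_of_generates hG1 hG2 _ (fun J Z hZ => WellGen.mapBijective_sigma F Z hZ)
      (fun A hA Y => hFbij A Y hA) X
  have : F.Faithful := ⟨fun {X Y} _ _ h => (hbij X Y).1 h⟩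
  have : F.Full := ⟨fun {X Y} => (hbij X Y).2⟩
  have : F.EssSurj := by
    -- Fullness makes the essential image triangulated, since morphisms between image objects lift
    -- and so do their cones.
    refine ⟨WellGen.prop_of_generates hG1' hG2' F.essImage (fun J Z hZ => ?_) fun B hB => ?_⟩
    · choose X e using hZ
      exact ⟨∐ X, ⟨(asIso (sigmaComparison F X)).symm ≪≫ Sigma.mapIso fun j => (e j).some⟩⟩
    · obtain ⟨A, _, e⟩ := hFsurj B hB
      exact ⟨A, e⟩
  have : F.IsEquivalence := {}
  exact WellGen.isTriangleEquivalence_of_isEquivalence F
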